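/- A $k$-graph is a $k$-uniform hypergraph $G$ on a finite vertex set $V(G)$; for $S\subseteq V(G)$, the degree $d_G(S)$ is the number of edges of $G$ containing $S$. A $k$-grid in $G$ consists of $k^2$ distinct vertices $x_{ij}$ ($1\le i,j\le k$) such that all the horizontal sets $\{x_{i1},\dots,x_{ik}\}$ ($i\in[k]$) and all the vertical sets $\{x_{1j},\dots,x_{kj}\}$ ($j\in[k]$) are edges of $G$. If each edge of $G$ is coloured either red or blue, the $k$-grid is called near-alternating if all but at most one of its horizontal edges are red and all but at most one of its vertical edges are blue. **Lemma.** There exist increasing functions $f,g\colon(0,1]\to(0,1]$ such that the following holds for all integers $k\ge 3$ and $n\ge 1$ and all $\varepsilon,\rho,\zeta\in(0,1]$ with $$\tfrac1n\le f(\zeta)\qquad\text{and}\qquad \zeta\le \min\{g(\varepsilon),\,g(\rho),\,g(1/k)\}.$$ Let $G$ be a $k$-graph on $n$ vertices, each of whose edges is coloured either red or blue, such that all but at most $\zeta n^{k-1}$ of the $(k-1)$-subsets $S$ of $V(G)$ satisfy $d_G(S)\ge(1/2+\varepsilon)n$. Then either $G$ contains a near-alternating $k$-grid, or at least one of the two colour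 classes (the set of red edges, the set of blue edges) has at most $\rho n^k$ edges. -/

import Mathlib

/-- A `k`-graph (`k`-uniform hypergraph) on the vertex set `V`: a set of `k`-subsets of `V`. -/
structure KGraph (V : Type*) (k : ℕ) where
  edges : Finset (Finset V)
  card_eq : ∀ e ∈ edges, e.card = k

/-- The two colours. -/
inductive EdgeColour
  | red
  | blue
  deriving DecidableEq

namespace KGraph

variable {V : Type*} {k : ℕ}

/-- The degree of a vertex set `S` in `G`: the number of edges of `G` containing `S`. -/
def degree [DecidableEq V] (G : KGraph V k) (S : Finset V) : ℕ :=
  (G.edges.filter (fun e => S ⊆ e)).card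

/-- A `2`-edge-colouring of `G`: every edge receives exactly one of the two colours. -/
abbrev Colouring (G : KGraph V k) : Type _ := {e : Finset V // e ∈ G.edges} → EdgeColour

/-- The set of edges of `G` that have colour `a`. -/
def colourClass (G : KGraph V k) (c : G.Colouring) (a : EdgeColour) : Finset (Finset V) :=
  (Finset.univ.filter (fun e => c e = a)).map (Function.Embedding.subtype _)

/-- The `i`-th horizontal edge `x_{i1} ⋯ x_{ik}`. -/
def horizontalEdge [DecidableEq V] (x : Fin k → Fin k → V) (i : Fin k) : Finset V :=
  Finset.univ.image (fun j => x i j)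

/-- The `j`-th vertical edge `x_{1j} ⋯ x_{kj}`. -/
def verticalEdge [DecidableEq V] (x : Fin k → Fin k → V) (j : Fin k) : Finset V :=
  Finset.univ.image (fun i => x i j)

/-- `x` spans a `k`-grid in `G`: the `k ^ 2` vertices `x i j` are pairwise distinct and all
horizontal and all vertical edges are edges of `G`. -/
structure IsGrid [DecidableEq V] (G : KGraph V k) (x : Fin k → Fin k → V) : Prop where
  distinct : Function.Injective (fun p : Fin k × Fin k => x p.1 p.2)
  horizontal_mem : ∀ i, horizontalEdge x i ∈ G.edges
  vertical_mem : ∀ j, verticalEdge x j ∈ G.edges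

/-- `x` spans a near-alternating `k`-grid in the coloured `k`-graph `G`: all horizontal edges but
at most one are red, and all vertical edges but at most one are blue. -/
structure IsNearAlternatingGrid [DecidableEq V] (G : KGraph V k) (c : G.Colouring)
    (x : Fin k → Fin k → V) : Prop extends IsGrid G x where
  horizontal_red :
    (Finset.univ.filter
      (fun i => horizontalEdge x i ∉ G.colourClass c EdgeColour.red)).card ≤ 1
  vertical_blue :
    (Finset.univ.filter
      (fun j => verticalEdge x j ∉ G.colourClass c EdgeColour.blue)).card ≤ 1

end KGraph

/-- An increasing function `(0, 1] → (0, 1]`, given by a real function of which only the values on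
`(0, 1]` matter. -/
def IsHierarchyFunction (f : ℝ → ℝ) : Prop :=
  Set.MapsTo f (Set.Ioc 0 1) (Set.Ioc 0 1) ∧ StrictMonoOn f (Set.Ioc 0 1)

/-! Write `k = d + 1` and count ordered tuples by density, so that degenerate tuples cost only
O(1/n). Call a `d`-tuple mixed if it has many red and many blue extensions. If both colours are
dense, mixed tuples have positive density. Otherwise almost every tuple is nearly monochromatic,
both types occur often, and changing coordinates one at a time from a red type to a blue type must
often pass directly from a red `S` to a blue `S'` differing in one place. Each has more than `n / 2`
extensions in its own colour, so they share an extension `z`. Replacing the differing coordinate by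
`z` gives a tuple with one red and one blue extension (`density_mixed_ge`).

A configuration of a tuple with a red and a blue extension is a `(d + 2)`-partite pattern, so by
convexity its `d`-fold blow-up also has positive density (`pow_density_le_density_blowUp`). In a
blow-up, part 0 extends every transversal of parts 2, ..., `d + 1` to a red edge, and part 1 to a
blue one. Arrange the latter parts in a Latin square, with part 0 as first column and part 1 as
first row: all other rows are red, all other columns blue. The corner is a common extension of parts
0 and 1, which exists because typical `d`-tuples have more than `n / 2` extensions. -/

open scoped BigOperators

/-! ### Densities of predicates on finite types -/

section Density

variable {α β : Type*} [Fintype α] [Fintype β]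

open scoped Classical in
/-- The proportion of the elements of a finite type that satisfy `p`. -/
noncomputable def density (p : α → Prop) : ℝ := 𝔼 a, if p a then (1 : ℝ) else 0

theorem density_eq_card_div (p : α → Prop) [DecidablePred p] :
    density p = ((Finset.univ.filter p).card : ℝ) / Fintype.card α := by
  classical
  rw [density, Fintype.expect_eq_sum_div_card, ← Finset.sum_boole]
  congr!

theorem density_nonneg (p : α → Prop) : 0 ≤ density p :=
  Finset.expect_nonneg fun a _ => by split_ifs <;> norm_num

theorem density_mono {p q : α → Prop} (h : ∀ a, p a → q a) : density p ≤ density q := by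
  refine Finset.expect_le_expect fun a _ => ?_
  by_cases hp : p a
  · simp [hp, h a hp]
  · simp only [hp, if_false]; split_ifs <;> norm_num

theorem density_le_one [Nonempty α] (p : α → Prop) : density p ≤ 1 :=
  Finset.expect_le Finset.univ_nonempty fun a _ => by split_ifs <;> norm_num

theorem density_or_le (p q : α → Prop) :
    density (fun a => p a ∨ q a) ≤ density p + density q := by
  rw [density, density, density, ← Finset.expect_add_distrib]
  refine Finset.expect_le_expect fun a _ => ?_
  by_cases hp : p a <;> by_cases hq : q a <;> simp [hp, hq]

theorem density_add_le_and [Nonempty α] (p q : α → Prop) :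
    density p + density q - 1 ≤ density (fun a => p a ∧ q a) := by
  have h1 : 𝔼 _a : α, (1 : ℝ) = 1 := Fintype.expect_const 1
  rw [density, density, density, ← Finset.expect_add_distrib, sub_le_iff_le_add]
  conv_rhs => rw [← h1, ← Finset.expect_add_distrib]
  refine Finset.expect_le_expect fun a _ => ?_
  by_cases hp : p a <;> by_cases hq : q a <;> norm_num [hp, hq]

theorem density_exists_le {ι : Type*} (s : Finset ι) (p : ι → α → Prop) :
    density (fun a => ∃ i ∈ s, p i a) ≤ ∑ i ∈ s, density (p i) := by
  classical
  simp only [density]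
  rw [← Finset.expect_sum_comm]
  refine Finset.expect_le_expect fun a _ => ?_
  split_ifs with h
  · obtain ⟨i, hi, hp⟩ := h
    calc (1 : ℝ) = if p i a then 1 else 0 := by simp [hp]
      _ ≤ _ := by
        convert Finset.single_le_sum (f := fun i => if p i a then (1 : ℝ) else 0)
          (fun j _ => by positivity) hi
  · exact Finset.sum_nonneg fun j _ => by split_ifs <;> norm_num

theorem density_equiv (e : α ≃ β) (p : β → Prop) : density (fun a => p (e a)) = density p :=
  Fintype.expect_equiv e _ _ fun _ => rfl

theorem expect_prod (f : α × β → ℝ) : 𝔼 x, f x = 𝔼 a, 𝔼 b, f (a, b) := by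
  rw [← Finset.univ_product_univ, Finset.expect_product]

theorem density_prod (p : α × β → Prop) : density p = 𝔼 a, density fun b => p (a, b) :=
  expect_prod _

theorem density_fst [Nonempty β] (p : α → Prop) :
    density (fun x : α × β => p x.1) = density p := by
  rw [density_prod]
  simp only [density]
  refine Finset.expect_congr rfl fun a _ => ?_
  by_cases h : p a <;> simp [h]

theorem density_and_prod (p : α → Prop) (q : β → Prop) :
    density (fun x : α × β => p x.1 ∧ q x.2) = density p * density q := by
  rw [density_prod, density.eq_def p, Finset.expect_mul]
  refine Finset.expect_congr rfl fun a _ => ?_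
  by_cases h : p a <;> simp [h, density_eq_card_div]

theorem mul_density_le_expect (p : α → Prop) (f : α → ℝ) (c : ℝ) (hf : ∀ a, 0 ≤ f a)
    (h : ∀ a, p a → c ≤ f a) : c * density p ≤ 𝔼 a, f a := by
  rw [density, Finset.mul_expect]
  refine Finset.expect_le_expect fun a _ => ?_
  by_cases hp : p a
  · simpa [hp] using h a hp
  · simpa [hp] using hf a

theorem exists_of_density_lt {p q : α → Prop} (h : density q < density p) :
    ∃ a, p a ∧ ¬ q a := by
  by_contra! H
  exact absurd (density_mono H) (not_le.mpr h)

end Density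

/-! ### Resampling one coordinate of a random tuple -/

section Resampling

variable {ι V : Type*} [Fintype ι] [DecidableEq ι] [Fintype V]

/-- Exchanging the `i`-th coordinate of a tuple with an additional element. -/
def exchangeCoord (i : ι) : Equiv.Perm ((ι → V) × V) where
  toFun x := (Function.update x.1 i x.2, x.1 i)
  invFun x := (Function.update x.1 i x.2, x.1 i)
  left_inv x := by simp
  right_inv x := by simp

theorem density_exchangeCoord (i : ι) (p : (ι → V) → V → Prop) :
    density (fun x : (ι → V) × V => p (Function.update x.1 i x.2) (x.1 i)) =
      density (fun x : (ι → V) × V => p x.1 x.2) :=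
  density_equiv (exchangeCoord i) fun x => p x.1 x.2

theorem density_resample [Nonempty V] (i : ι) (p : (ι → V) → Prop) :
    density p = density (fun x : (ι → V) × V => p (Function.update x.1 i x.2)) := by
  rw [density_exchangeCoord i fun a _ => p a, density_fst]

theorem density_eval [Nonempty V] (i : ι) (p : V → Prop) :
    density (fun a : ι → V => p (a i)) = density p := by
  rw [density_resample i, ← density_fst (β := ι → V) p,
    ← density_equiv (Equiv.prodComm (ι → V) V)]
  simp only [Equiv.prodComm_apply, Prod.fst_swap, Function.update_self]

theorem density_eval_eq [Nonempty V] {i j : ι} (h : i ≠ j) :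
    density (fun a : ι → V => a i = a j) = 1 / Fintype.card V := by
  classical
  rw [density_resample i, density_prod]
  simp only [Function.update_self, Function.update_of_ne h.symm]
  rw [← Fintype.expect_const (ι := ι → V) (1 / (Fintype.card V : ℝ))]
  refine Finset.expect_congr rfl fun a _ => ?_
  have hs : Finset.univ.filter (fun b => b = a j) = {a j} := by ext; simp
  rw [density_eq_card_div, hs, Finset.card_singleton, Nat.cast_one]

theorem density_not_injective_le [Nonempty V] :
    density (fun a : ι → V => ¬ Function.Injective a) ≤
      (Fintype.card ι : ℝ) ^ 2 / Fintype.card V := by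
  calc density (fun a : ι → V => ¬ Function.Injective a)
      ≤ density (fun a : ι → V => ∃ x ∈ (Finset.univ : Finset ι).offDiag, a x.1 = a x.2) := by
        refine density_mono fun a ha => ?_
        simp only [Function.Injective, not_forall] at ha
        obtain ⟨i, j, hij, hne⟩ := ha
        exact ⟨(i, j), by simpa using hne, hij⟩
    _ ≤ ∑ x ∈ (Finset.univ : Finset ι).offDiag, density (fun a : ι → V => a x.1 = a x.2) :=
        density_exists_le _ _
    _ = (Finset.univ : Finset ι).offDiag.card * (1 / (Fintype.card V : ℝ)) := by
        rw [Finset.sum_congr rfl fun x hx => density_eval_eq (by simpa using hx)]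
        simp
    _ ≤ _ := by
        rw [mul_one_div, Finset.offDiag_card, ← sq, Finset.card_univ]
        gcongr
        exact_mod_cast Nat.sub_le _ _

end Resampling

/-! ### Blow-ups of partite patterns -/

section BlowUp

variable {V : Type*} [Fintype V] [Nonempty V]

theorem pow_expect_le_expect_pow {α : Type*} [Fintype α] [Nonempty α] (f : α → ℝ)
    (hf : ∀ a, 0 ≤ f a) (m : ℕ) : (𝔼 a, f a) ^ m ≤ 𝔼 a, f a ^ m := by
  have := Real.pow_arith_mean_le_arith_mean_pow (Finset.univ : Finset α)
    (fun _ => (1 : ℝ) / Fintype.card α) f (fun _ _ => by positivity) (by simp)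
    (fun a _ => hf a) m
  rw [Fintype.expect_eq_sum_div_card, Fintype.expect_eq_sum_div_card]
  simpa [← Finset.mul_sum, div_eq_inv_mul] using this

/-- Averages over tuples, split according to the first coordinate. -/
theorem expect_fin_succ {X : Type*} [Fintype X] {D : ℕ} (f : (Fin (D + 1) → X) → ℝ) :
    𝔼 t, f t = 𝔼 x, 𝔼 t, f (Fin.cons x t) := by
  rw [← expect_prod fun p : X × (Fin D → X) => f (Fin.cons p.1 p.2)]
  exact (Fintype.expect_equiv (Fin.consEquiv fun _ => X) _ _ fun _ => rfl).symm

/-- Blow up one part at a time. The power mean inequality for the average over the first coordinate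
creates its `m` copies; a second use, for exponent `m ^ D`, moves the power inside the average over
these copies. For fixed copies, induction applies to the product of the weights. -/
theorem pow_expect_le_expect_blowUp (m D : ℕ) (w : (Fin D → V) → ℝ) (hw : ∀ t, 0 ≤ w t) :
    (𝔼 t, w t) ^ m ^ D ≤
      𝔼 A : Fin D → Fin m → V, ∏ φ : Fin D → Fin m, w fun l => A l (φ l) := by
  induction D with
  | zero => simp [Subsingleton.elim _ (default : Fin 0 → V)]
  | succ D ih =>
    have key : ∀ x : Fin m → V, (𝔼 t, ∏ i, w (Fin.cons (x i) t)) ^ m ^ D ≤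
        𝔼 A : Fin D → Fin m → V, ∏ φ : Fin (D + 1) → Fin m,
          w fun l => (Fin.cons x A : Fin (D + 1) → Fin m → V) l (φ l) := by
      intro x
      refine (ih (fun t => ∏ i, w (Fin.cons (x i) t))
        fun t => Finset.prod_nonneg fun i _ => hw _).trans (le_of_eq ?_)
      refine Finset.expect_congr rfl fun A _ => ?_
      rw [← Fintype.prod_equiv (Fin.consEquiv fun _ => Fin m) (fun p => w fun l =>
        (Fin.cons x A : Fin (D + 1) → Fin m → V) l ((Fin.cons p.1 p.2 : Fin (D + 1) → Fin m) l))
        _ fun _ => rfl, Fintype.prod_prod_type, Finset.prod_comm]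
      refine Finset.prod_congr rfl fun φ _ => Finset.prod_congr rfl fun i _ => congrArg w ?_
      funext l
      refine Fin.cases ?_ (fun l => ?_) l <;> simp
    calc (𝔼 t, w t) ^ m ^ (D + 1)
        = ((𝔼 t, 𝔼 x, w (Fin.cons x t)) ^ m) ^ m ^ D := by
          rw [expect_fin_succ, Finset.expect_comm, ← pow_mul, pow_succ']
      _ ≤ (𝔼 t, (𝔼 x, w (Fin.cons x t)) ^ m) ^ m ^ D := by
          gcongr
          · exact pow_nonneg (Finset.expect_nonneg fun t _ =>
              Finset.expect_nonneg fun x _ => hw _) _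
          · exact pow_expect_le_expect_pow _ (fun t => Finset.expect_nonneg fun x _ => hw _) _
      _ = (𝔼 x : Fin m → V, 𝔼 t, ∏ i, w (Fin.cons (x i) t)) ^ m ^ D := by
          rw [Finset.expect_comm]
          congr 1
          refine Finset.expect_congr rfl fun t _ => ?_
          rw [Finset.expect_pow]
          simp
      _ ≤ 𝔼 x : Fin m → V, (𝔼 t, ∏ i, w (Fin.cons (x i) t)) ^ m ^ D :=
          pow_expect_le_expect_pow _ (fun x => Finset.expect_nonneg fun t _ =>
            Finset.prod_nonneg fun i _ => hw _) _
      _ ≤ _ := by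
          rw [expect_fin_succ]
          exact Finset.expect_le_expect fun x _ => key x

theorem pow_density_le_density_blowUp (m D : ℕ) (p : (Fin D → V) → Prop) :
    density p ^ m ^ D ≤
      density fun A : Fin D → Fin m → V => ∀ φ : Fin D → Fin m, p fun l => A l (φ l) := by
  classical
  refine (pow_expect_le_expect_blowUp m D _ fun t => by split_ifs <;> norm_num).trans_eq ?_
  refine Finset.expect_congr rfl fun A _ => ?_
  rw [Finset.prod_boole]
  simp

end BlowUp

/-! ### Paths between two random tuples -/

section Hybrid

variable {V : Type*} {d : ℕ}

/-- Exchanging the first `j` coordinates of two tuples. -/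
def exchangePrefix (j : ℕ) : Equiv.Perm ((Fin d → V) × (Fin d → V)) where
  toFun x := (fun l => if l.val < j then x.2 l else x.1 l,
    fun l => if l.val < j then x.1 l else x.2 l)
  invFun x := (fun l => if l.val < j then x.2 l else x.1 l,
    fun l => if l.val < j then x.1 l else x.2 l)
  left_inv x := by ext l <;> by_cases h : l.val < j <;> simp [h]
  right_inv x := by ext l <;> by_cases h : l.val < j <;> simp [h]

theorem exchangePrefix_succ_fst (j : Fin d) (x : (Fin d → V) × (Fin d → V)) :
    (exchangePrefix (j + 1) x).1 =
      Function.update (exchangePrefix j x).1 j ((exchangePrefix j x).2 j) := by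
  ext l
  rcases eq_or_ne l j with rfl | h
  · simp [exchangePrefix]
  · have : l ≤ j ↔ l < j := by
      have := Fin.val_ne_of_ne h
      omega
    simp [exchangePrefix, h, this]

variable [Fintype V]

theorem density_exchangePrefix_fst [Nonempty V] (j : ℕ) (p : (Fin d → V) → Prop) :
    density (fun x => p (exchangePrefix j x).1) = density p := by
  rw [density_equiv (exchangePrefix j) fun x => p x.1, density_fst]

/-- A random pair of tuples in `R × B` is joined by a path that changes one coordinate at a time:
it leaves `R ∪ B` or jumps from `R` to `B`. -/
theorem density_mul_density_le_of_path [Nonempty V] (R B : (Fin d → V) → Prop)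
    (hRB : ∀ S, R S → ¬ B S) (β J : ℝ) (hβ : density (fun S => ¬ (R S ∨ B S)) ≤ β)
    (hJ : ∀ i, density (fun x : (Fin d → V) × V => R x.1 ∧ B (Function.update x.1 i x.2)) ≤ J) :
    density R * density B ≤ (d + 1) * β + d * J := by
  have hjump : ∀ i : Fin d, density (fun x : (Fin d → V) × (Fin d → V) =>
      R (exchangePrefix i x).1 ∧ B (exchangePrefix (i + 1) x).1) ≤ J := by
    intro i
    -- The exchanged pair is again uniform, and the jump uses only coordinate `i` of its second
    -- tuple.
    refine le_trans (le_of_eq ?_) (hJ i)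
    simp only [exchangePrefix_succ_fst]
    rw [density_equiv (exchangePrefix i) fun x => R x.1 ∧ B (Function.update x.1 i (x.2 i)),
      density_prod, density_prod]
    exact Finset.expect_congr rfl fun S _ =>
      density_eval i fun y => R S ∧ B (Function.update S i y)
  rw [← density_and_prod]
  calc density (fun x : (Fin d → V) × (Fin d → V) => R x.1 ∧ B x.2)
      ≤ density (fun x : (Fin d → V) × (Fin d → V) =>
          (∃ j ∈ Finset.range (d + 1),
            ¬ (R (exchangePrefix j x).1 ∨ B (exchangePrefix j x).1)) ∨
          ∃ i ∈ (Finset.univ : Finset (Fin d)),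
            R (exchangePrefix i x).1 ∧ B (exchangePrefix (i + 1) x).1) := by
        refine density_mono fun x hx => ?_
        by_contra! H
        obtain ⟨h1, h2⟩ := H
        -- A path that avoids both events never leaves `R`, yet it ends at `x.2`, which lies in `B`.
        have hR : ∀ j ≤ d, R (exchangePrefix j x).1 := by
          intro j
          induction j with
          | zero => intro _; simpa [exchangePrefix] using hx.1
          | succ j ih =>
            intro hj
            refine (h1 (j + 1) (by simpa using hj)).resolve_right ?_
            exact h2 ⟨j, hj⟩ (Finset.mem_univ _) (ih (by omega))
        refine hRB _ (hR d le_rfl) ?_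
        simpa [exchangePrefix] using hx.2
    _ ≤ _ := density_or_le _ _
    _ ≤ ∑ _j ∈ Finset.range (d + 1), β + ∑ _i : Fin d, J := by
        refine add_le_add ((density_exists_le _ _).trans (Finset.sum_le_sum fun j _ => ?_))
          ((density_exists_le _ _).trans (Finset.sum_le_sum fun i _ => hjump i))
        rwa [density_exchangePrefix_fst j fun S => ¬ (R S ∨ B S)]
    _ = _ := by simp

end Hybrid

/-! ### Tuples with extensions in both colours -/

section Mixed

variable {V : Type*} [Fintype V] [Nonempty V] {d : ℕ}

/-- Replacing a coordinate by a common extension of two tuples that differ only there yields a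
tuple with extensions of both kinds. -/
theorem mul_density_jump_le (red blue : (Fin d → V) → V → Prop)
    (hred : ∀ S i z, red (Function.update S i z) (S i) ↔ red S z)
    (hblue : ∀ S i z, blue (Function.update S i z) (S i) ↔ blue S z)
    (R B : (Fin d → V) → Prop) (τ : ℝ)
    (hR : ∀ S, R S → 1 / 2 + τ / 2 ≤ density (red S))
    (hB : ∀ S, B S → 1 / 2 + τ / 2 ≤ density (blue S)) (i : Fin d) :
    τ * density (fun x : (Fin d → V) × V => R x.1 ∧ B (Function.update x.1 i x.2)) ≤
      density fun x : ((Fin d → V) × V) × V => red x.1.1 x.1.2 ∧ blue x.1.1 x.2 := by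
  -- With `z` the common extension of `S` and `update S i y`, this sends `(S, y, z)` to the tuple
  -- `update S i z` with red extension `S i` and blue extension `y`.
  let e : Equiv.Perm (((Fin d → V) × V) × V) :=
    { toFun := fun x => ((Function.update x.1.1 i x.2, x.1.1 i), x.1.2)
      invFun := fun x => ((Function.update x.1.1 i x.1.2, x.2), x.1.1 i)
      left_inv := fun x => by simp
      right_inv := fun x => by simp }
  rw [← density_equiv e fun x : ((Fin d → V) × V) × V => red x.1.1 x.1.2 ∧ blue x.1.1 x.2]
  refine (density_prod _).ge.trans' (mul_density_le_expect _ _ _ (fun _ => density_nonneg _)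
    fun x hx => ?_)
  -- Two sets of density at least `1 / 2 + τ / 2` meet in density at least `τ`.
  have h := density_add_le_and (red x.1) (blue (Function.update x.1 i x.2))
  have h1 := hR _ hx.1
  have h2 := hB _ hx.2
  refine le_trans (by linarith) (h.trans (density_mono fun z hz => ?_))
  refine ⟨(hred _ _ _).mpr hz.1, ?_⟩
  have := (hblue (Function.update x.1 i x.2) i z).mpr hz.2
  simpa [e] using this

/-- If both colours have positive density and most tuples have more than half of all vertices as
extensions, then a positive proportion of the tuples have extensions in both colours. -/
theorem density_mixed_ge (red blue : (Fin d → V) → V → Prop)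
    (hred : ∀ S i z, red (Function.update S i z) (S i) ↔ red S z)
    (hblue : ∀ S i z, blue (Function.update S i z) (S i) ↔ blue S z)
    (τ : ℝ) (hτ0 : 0 < τ) (hτ1 : τ ≤ 1)
    (hgood : density (fun S => density (fun z => red S z ∨ blue S z) < 1 / 2 + τ) ≤
      τ ^ 2 / (128 * (d + 1)))
    (hR : τ ≤ density fun x : (Fin d → V) × V => red x.1 x.2)
    (hB : τ ≤ density fun x : (Fin d → V) × V => blue x.1 x.2) :
    τ ^ 4 / (512 * (d + 1)) ≤
      density fun x : ((Fin d → V) × V) × V => red x.1.1 x.1.2 ∧ blue x.1.1 x.2 := by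
  by_contra! hM
  set M := density fun x : ((Fin d → V) × V) × V => red x.1.1 x.1.2 ∧ blue x.1.1 x.2 with hMdef
  let good : (Fin d → V) → Prop := fun S => 1 / 2 + τ ≤ density (red S) + density (blue S)
  let R : (Fin d → V) → Prop := fun S => good S ∧ density (blue S) < τ / 2
  let B : (Fin d → V) → Prop := fun S => good S ∧ density (red S) < τ / 2
  have hd : (0 : ℝ) < d + 1 := by positivity
  have hbad : density (fun S => ¬ good S) ≤ τ ^ 2 / (128 * (d + 1)) :=
    (density_mono fun S hS => lt_of_le_of_lt (density_or_le _ _) (not_le.mp hS)).trans hgood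
  -- Given `S`, the two extensions are chosen independently.
  have hmix : (τ / 2) ^ 2 * density (fun S => τ / 2 ≤ density (red S) ∧ τ / 2 ≤ density (blue S))
      ≤ M := by
    have : M = 𝔼 S, density (red S) * density (blue S) := by
      rw [hMdef, ← density_equiv (Equiv.prodAssoc (Fin d → V) V V).symm, density_prod]
      exact Finset.expect_congr rfl fun S _ => density_and_prod (red S) (blue S)
    rw [this]
    refine mul_density_le_expect _ _ _
      (fun S => mul_nonneg (density_nonneg _) (density_nonneg _)) fun S hS => ?_
    nlinarith [hS.1, hS.2]
  -- Twice the bound in `hgood`: one share for tuples that are not good, one for mixed tuples.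
  set β := τ ^ 2 / (64 * (d + 1)) with hβdef
  have hβ : density (fun S => ¬ (R S ∨ B S)) ≤ β := by
    have h1 : density (fun S => ¬ (R S ∨ B S)) ≤ density (fun S => ¬ good S) +
        density (fun S => τ / 2 ≤ density (red S) ∧ τ / 2 ≤ density (blue S)) := by
      refine (density_mono fun S hS => ?_).trans (density_or_le _ _)
      by_cases hg : good S
      · right
        constructor
        · by_contra! h
          exact hS (Or.inr ⟨hg, h⟩)
        · by_contra! h
          exact hS (Or.inl ⟨hg, h⟩)
      · exact Or.inl hg
    have h2 : density (fun S => τ / 2 ≤ density (red S) ∧ τ / 2 ≤ density (blue S)) ≤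
        τ ^ 2 / (128 * (d + 1)) := by
      have h3 : (τ / 2) ^ 2 * (τ ^ 2 / (128 * (d + 1))) = τ ^ 4 / (512 * (d + 1)) := by
        field_simp
        norm_num
      refine le_of_mul_le_mul_left ?_ (by positivity : 0 < (τ / 2) ^ 2)
      linarith
    have h4 : β = τ ^ 2 / (128 * (d + 1)) + τ ^ 2 / (128 * (d + 1)) := by
      rw [hβdef]; field_simp; norm_num
    linarith
  have hβ' : (d + 1) * β = τ ^ 2 / 64 := by rw [hβdef]; field_simp
  have hβ4 : β ≤ τ / 4 := by
    have h0 : (0 : ℝ) ≤ d := Nat.cast_nonneg d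
    have hb0 : 0 ≤ β := by positivity
    nlinarith
  have hpath := density_mul_density_le_of_path R B
    (fun S h1 h2 => by
      have := h1.1
      have := h1.2
      have := h2.2
      simp only [good] at *
      linarith) β (M / τ) hβ fun i => by
      rw [le_div_iff₀ hτ0, mul_comm]
      refine mul_density_jump_le red blue hred hblue R B τ (fun S hS => ?_) (fun S hS => ?_) i
      · have := hS.1
        have := hS.2
        simp only [good] at *
        linarith
      · have := hS.1
        have := hS.2
        simp only [good] at *
        linarith
  -- Stated symmetrically to serve both colours: tuples in `Q` contribute at most `τ / 2` to the
  -- density of `p`, and those outside `P` and `Q` at most `β ≤ τ / 4`.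
  have hlarge : ∀ (p q : (Fin d → V) → V → Prop) (P Q : (Fin d → V) → Prop),
      (∀ S, Q S → density (p S) < τ / 2) → density (fun S => ¬ (P S ∨ Q S)) ≤ β →
      τ ≤ density (fun x : (Fin d → V) × V => p x.1 x.2) → τ / 4 ≤ density P := by
    intro p _ P Q hQ hβ hp
    have h1 : density (fun x : (Fin d → V) × V => p x.1 x.2) ≤
        density P + density (fun S => ¬ (P S ∨ Q S)) + τ / 2 := by
      have h2 : 𝔼 _S : Fin d → V, τ / 2 = τ / 2 := Fintype.expect_const _
      rw [density_prod, density, density, ← h2, ← Finset.expect_add_distrib,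
        ← Finset.expect_add_distrib]
      refine Finset.expect_le_expect fun S _ => ?_
      have h3 := density_le_one (p S)
      by_cases hP : P S
      · simp only [hP, if_true, true_or, not_true, if_false]; linarith
      · by_cases hq : Q S
        · simp only [hP, hq, or_true, not_true, if_false]
          linarith [hQ S hq]
        · simp only [hP, hq, or_false, not_false_eq_true, if_true, if_false]; linarith
    linarith
  have hRl := hlarge red blue R B (fun S hS => hS.2) hβ hR
  have hBl := hlarge blue red B R (fun S hS => hS.2) (by simpa only [or_comm] using hβ) hB
  have hJ : d * (M / τ) ≤ τ ^ 2 / 64 := by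
    have h1 : M / τ ≤ τ ^ 3 / (512 * (d + 1)) := by
      rw [div_le_iff₀ hτ0]
      exact hM.le.trans_eq (by ring)
    calc d * (M / τ) ≤ (d + 1) * (τ ^ 3 / (512 * (d + 1))) := by
          gcongr
          · exact div_nonneg (density_nonneg _) hτ0.le
          · linarith
      _ = τ ^ 3 / 512 := by field_simp
      _ ≤ τ ^ 2 / 64 := by nlinarith [sq_nonneg τ, mul_nonneg (sq_nonneg τ) (sub_nonneg.mpr hτ1)]
  have hprod : τ / 4 * (τ / 4) ≤ density R * density B :=
    mul_le_mul hRl hBl (by positivity) (density_nonneg _)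
  -- The path bound gives `τ ^ 2 / 16 ≤ τ ^ 2 / 64 + τ ^ 2 / 64`, which is absurd.
  nlinarith [sq_nonneg τ, pow_pos hτ0 2]

end Mixed

/-! ### From edges and degrees to densities of tuples -/

namespace KGraph

section Extensions

theorem mem_edges_of_mem_colourClass {V : Type*} {k : ℕ} {G : KGraph V k} {c : G.Colouring} {a : EdgeColour}
    {e : Finset V} (h : e ∈ G.colourClass c a) : e ∈ G.edges := by
  simp only [colourClass, Finset.mem_map] at h
  obtain ⟨x, -, rfl⟩ := h
  exact x.2

theorem mem_colourClass_red_or_blue {V : Type*} {k : ℕ} {G : KGraph V k} (c : G.Colouring) {e : Finset V} :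
    e ∈ G.colourClass c EdgeColour.red ∨ e ∈ G.colourClass c EdgeColour.blue ↔ e ∈ G.edges := by
  refine ⟨fun h => h.elim mem_edges_of_mem_colourClass mem_edges_of_mem_colourClass, fun h => ?_⟩
  simp only [colourClass, Finset.mem_map, Finset.mem_filter, Finset.mem_univ, true_and]
  cases hc : c ⟨e, h⟩
  · exact Or.inl ⟨⟨e, h⟩, hc, rfl⟩
  · exact Or.inr ⟨⟨e, h⟩, hc, rfl⟩

variable {V : Type*} [DecidableEq V] {d : ℕ}

theorem insert_image_update (S : Fin d → V) (i : Fin d) (z : V) :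
    insert (S i) (Finset.univ.image (Function.update S i z)) = insert z (Finset.univ.image S) := by
  ext v
  simp only [Finset.mem_insert, Finset.mem_image, Finset.mem_univ, true_and]
  constructor
  · rintro (rfl | ⟨j, rfl⟩)
    · exact Or.inr ⟨i, rfl⟩
    · rcases eq_or_ne j i with rfl | h
      · simp
      · exact Or.inr ⟨j, by simp [h]⟩
  · rintro (rfl | ⟨j, rfl⟩)
    · exact Or.inr ⟨i, by simp⟩
    · rcases eq_or_ne j i with rfl | h
      · simp
      · exact Or.inr ⟨j, by simp [h]⟩

/-- The vertex `z` extends the tuple `S` to an edge of colour `a`. -/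
def Extends (G : KGraph V (d + 1)) (c : G.Colouring) (a : EdgeColour) (S : Fin d → V) (z : V) :
    Prop :=
  insert z (Finset.univ.image S) ∈ G.colourClass c a

variable (G : KGraph V (d + 1)) (c : G.Colouring)

/-- An edge does not remember which of its vertices is the extension; this is the symmetry that
`density_mixed_ge` requires. -/
theorem extends_update (a : EdgeColour) (S : Fin d → V) (i : Fin d) (z : V) :
    G.Extends c a (Function.update S i z) (S i) ↔ G.Extends c a S z := by
  rw [Extends, Extends, insert_image_update]

variable [Fintype V]

theorem degree_le_card_extensions (T : Finset V) (hT : T.card = d) :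
    G.degree T ≤ (Finset.univ.filter fun z => insert z T ∈ G.edges).card := by
  refine Finset.card_le_card_of_surjOn (fun z => insert z T) fun e he => ?_
  simp only [Finset.coe_filter, Set.mem_ofPred_eq] at he
  obtain ⟨z, -, hz⟩ := Finset.exists_eq_insert_iff.mpr ⟨he.2, by rw [hT, G.card_eq e he.1]⟩
  exact ⟨z, by simpa [hz] using he.1, hz⟩

theorem density_image_mem_le (F : Finset (Finset V)) (hF : ∀ T ∈ F, T.card = d) :
    density (fun S : Fin d → V => Finset.univ.image S ∈ F) ≤
      F.card * ((d : ℝ) ^ d / (Fintype.card V : ℝ) ^ d) := by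
  calc density (fun S : Fin d → V => Finset.univ.image S ∈ F)
      ≤ density (fun S : Fin d → V => ∃ T ∈ F, ∀ i, S i ∈ T) :=
        density_mono fun S hS => ⟨_, hS, fun i => Finset.mem_image_of_mem _ (Finset.mem_univ _)⟩
    _ ≤ ∑ T ∈ F, density (fun S : Fin d → V => ∀ i, S i ∈ T) := density_exists_le _ _
    _ = ∑ _T ∈ F, (d : ℝ) ^ d / (Fintype.card V : ℝ) ^ d := by
        refine Finset.sum_congr rfl fun T hT => ?_
        have h : (Finset.univ.filter fun S : Fin d → V => ∀ i, S i ∈ T) =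
            Fintype.piFinset fun _ => T := by
          ext S; simp
        rw [density_eq_card_div, h]
        simp [hF T hT]
    _ = _ := by simp

variable [Nonempty V]

theorem density_few_extensions_le (ε ζ : ℝ)
    (h : (((Finset.univ.powersetCard d).filter
        (fun S : Finset V => (G.degree S : ℝ) < (1 / 2 + ε) * (Fintype.card V : ℝ))).card : ℝ)
      ≤ ζ * (Fintype.card V : ℝ) ^ d) :
    density (fun S : Fin d → V => density (fun z => G.Extends c EdgeColour.red S z ∨
        G.Extends c EdgeColour.blue S z) < 1 / 2 + ε) ≤
      (d : ℝ) ^ 2 / Fintype.card V + d ^ d * ζ := by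
  set F := (Finset.univ.powersetCard d).filter
    (fun S : Finset V => (G.degree S : ℝ) < (1 / 2 + ε) * (Fintype.card V : ℝ)) with hF
  have hn : (0 : ℝ) < Fintype.card V := by exact_mod_cast Fintype.card_pos
  calc _ ≤ density (fun S : Fin d → V => ¬ Function.Injective S ∨ Finset.univ.image S ∈ F) := by
        refine density_mono fun S hS => ?_
        by_cases hinj : Function.Injective S
        · right
          have hcard : (Finset.univ.image S).card = d := by
            rw [Finset.card_image_of_injective _ hinj, Finset.card_univ, Fintype.card_fin]
          simp only [Extends, mem_colourClass_red_or_blue] at hS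
          rw [density_eq_card_div, div_lt_iff₀ hn] at hS
          rw [hF, Finset.mem_filter, Finset.mem_powersetCard]
          refine ⟨⟨Finset.subset_univ _, hcard⟩, lt_of_le_of_lt ?_ hS⟩
          exact_mod_cast degree_le_card_extensions G _ hcard
        · exact Or.inl hinj
    _ ≤ density (fun S : Fin d → V => ¬ Function.Injective S) +
          density (fun S : Fin d → V => Finset.univ.image S ∈ F) := density_or_le _ _
    _ ≤ (d : ℝ) ^ 2 / Fintype.card V +
          ζ * (Fintype.card V : ℝ) ^ d * ((d : ℝ) ^ d / (Fintype.card V : ℝ) ^ d) := by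
        refine add_le_add ?_ ((density_image_mem_le F fun T hT => ?_).trans ?_)
        · simpa using density_not_injective_le (ι := Fin d) (V := V)
        · exact (Finset.mem_powersetCard.mp (Finset.mem_filter.mp hT).1).2
        · gcongr
    _ = _ := by field_simp

/-- Every edge arises from at least one pair of a tuple and an extension; the number of orderings is
not exploited. -/
theorem le_density_extends (a : EdgeColour) (ρ : ℝ)
    (h : ρ * (Fintype.card V : ℝ) ^ (d + 1) ≤ (G.colourClass c a).card) :
    ρ ≤ density fun x : (Fin d → V) × V => G.Extends c a x.1 x.2 := by
  classical
  have hn : (0 : ℝ) < Fintype.card V := by exact_mod_cast Fintype.card_pos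
  rw [density_eq_card_div, le_div_iff₀ (by positivity)]
  have hc : (Fintype.card ((Fin d → V) × V) : ℝ) = (Fintype.card V : ℝ) ^ (d + 1) := by
    simp [pow_succ]
  rw [hc]
  refine h.trans ?_
  norm_cast
  refine Finset.card_le_card_of_surjOn (fun x => insert x.2 (Finset.univ.image x.1)) fun e he => ?_
  have hcard := G.card_eq e (mem_edges_of_mem_colourClass he)
  obtain ⟨z, hz⟩ : e.Nonempty := by
    rw [← Finset.card_pos, hcard]; omega
  have hT : (e.erase z).card = d := by rw [Finset.card_erase_of_mem hz, hcard]; rfl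
  let S : Fin d → V := fun i => ((e.erase z).equivFinOfCardEq hT).symm i
  have hS : Finset.univ.image S = e.erase z := by
    ext v
    simp only [Finset.mem_image, Finset.mem_univ, true_and, S]
    constructor
    · rintro ⟨i, rfl⟩
      exact (((e.erase z).equivFinOfCardEq hT).symm i).2
    · intro hv
      exact ⟨(e.erase z).equivFinOfCardEq hT ⟨v, hv⟩, by simp⟩
  have he' : insert z (Finset.univ.image S) = e := by rw [hS, Finset.insert_erase hz]
  exact ⟨(S, z), Finset.mem_coe.mpr (Finset.mem_filter.mpr ⟨Finset.mem_univ _, by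
    rw [Extends, he']; exact he⟩), he'⟩

end Extensions

/-! ### The grid built from a Latin square -/

section Grid

variable {V : Type*} {d : ℕ}

/-- The array with corner `z`, first row `A 1`, first column `A 0`, and the Latin square on the
remaining parts of `A` elsewhere. -/
def latinArray (A : Fin (d + 2) → Fin d → V) (z : V) (p q : Fin (d + 1)) : V :=
  Fin.cases (Fin.cases z (fun j => A 1 j) q)
    (fun i => Fin.cases (A 0 i) (fun j => A (i + j).succ.succ i) q) p

variable (A : Fin (d + 2) → Fin d → V) (z : V)

theorem latinArray_injective
    (hA : Function.Injective fun p : Fin (d + 2) × Fin d => A p.1 p.2) (hz : ∀ l i, A l i ≠ z) :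
    Function.Injective fun p : Fin (d + 1) × Fin (d + 1) => latinArray A z p.1 p.2 := by
  have hA' : ∀ l i l' i', A l i = A l' i' ↔ l = l' ∧ i = i' := fun l i l' i' =>
    ⟨fun h => Prod.ext_iff.mp (@hA (l, i) (l', i') h), fun h => by rw [h.1, h.2]⟩
  have h01 : (0 : Fin (d + 2)) ≠ 1 := by simp
  have h0 : ∀ l : Fin d, (0 : Fin (d + 2)) ≠ l.succ.succ := fun l => by simp [Fin.ext_iff]
  have h1 : ∀ l : Fin d, (1 : Fin (d + 2)) ≠ l.succ.succ := fun l => by simp [Fin.ext_iff]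
  rintro ⟨p, q⟩ ⟨p', q'⟩ h
  have hne : ∀ i : Fin d, NeZero d := fun i => NeZero.of_pos i.pos
  revert h
  refine Fin.cases ?_ (fun i => ?_) p <;> refine Fin.cases ?_ (fun j => ?_) q <;>
    refine Fin.cases ?_ (fun i' => ?_) p' <;> refine Fin.cases ?_ (fun j' => ?_) q' <;>
    simp [latinArray, hA', hz, fun l i => (hz l i).symm, h01, h01.symm,
      h0, fun l => (h0 l).symm, h1, fun l => (h1 l).symm]
  have := hne i
  rintro h rfl
  exact ⟨rfl, add_left_cancel h⟩

variable [DecidableEq V]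

theorem horizontalEdge_latinArray_zero :
    horizontalEdge (latinArray A z) 0 = insert z (Finset.univ.image (A 1)) := by
  ext v
  simp [horizontalEdge, latinArray, Fin.exists_fin_succ, eq_comm]

theorem verticalEdge_latinArray_zero :
    verticalEdge (latinArray A z) 0 = insert z (Finset.univ.image (A 0)) := by
  ext v
  simp [verticalEdge, latinArray, Fin.exists_fin_succ, eq_comm]

theorem horizontalEdge_latinArray_succ (i : Fin d) :
    horizontalEdge (latinArray A z) i.succ =
      insert (A 0 i) (Finset.univ.image fun l : Fin d => A l.succ.succ i) := by
  have := NeZero.of_pos i.pos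
  ext v
  simp only [horizontalEdge, latinArray, Finset.mem_image, Finset.mem_univ, true_and,
    Fin.exists_fin_succ, Fin.cases_zero, Fin.cases_succ, Finset.mem_insert, eq_comm (a := v)]
  -- Latin property: along row `i`, the part index `i + j` runs once through all of `Fin d`.
  refine or_congr_right ⟨fun ⟨j, h⟩ => ⟨i + j, h⟩, fun ⟨l, h⟩ => ⟨l - i, ?_⟩⟩
  rwa [add_sub_cancel]

theorem verticalEdge_latinArray_succ (j : Fin d) :
    verticalEdge (latinArray A z) j.succ =
      insert (A 1 j) (Finset.univ.image fun l : Fin d => A l.succ.succ (l - j)) := by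
  have := NeZero.of_pos j.pos
  ext v
  simp only [verticalEdge, latinArray, Finset.mem_image, Finset.mem_univ, true_and,
    Fin.exists_fin_succ, Fin.cases_zero, Fin.cases_succ, Finset.mem_insert, eq_comm (a := v)]
  refine or_congr_right ⟨fun ⟨i, h⟩ => ⟨i + j, ?_⟩, fun ⟨l, h⟩ => ⟨l - j, ?_⟩⟩
  · rwa [add_sub_cancel_right]
  · rwa [sub_add_cancel]

theorem isNearAlternatingGrid_latinArray (G : KGraph V (d + 1)) (c : G.Colouring)
    (hA : Function.Injective fun p : Fin (d + 2) × Fin d => A p.1 p.2) (hz : ∀ l i, A l i ≠ z)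
    (hcol : insert z (Finset.univ.image (A 0)) ∈ G.edges)
    (hrow : insert z (Finset.univ.image (A 1)) ∈ G.edges)
    (hred : ∀ φ : Fin (d + 2) → Fin d,
      G.Extends c EdgeColour.red (fun l => A l.succ.succ (φ l.succ.succ)) (A 0 (φ 0)))
    (hblue : ∀ φ : Fin (d + 2) → Fin d,
      G.Extends c EdgeColour.blue (fun l => A l.succ.succ (φ l.succ.succ)) (A 1 (φ 1))) :
    G.IsNearAlternatingGrid c (latinArray A z) := by
  have hh : ∀ i : Fin d, horizontalEdge (latinArray A z) i.succ ∈
      G.colourClass c EdgeColour.red := fun i => by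
    rw [horizontalEdge_latinArray_succ]
    exact hred fun _ => i
  have hv : ∀ j : Fin d, verticalEdge (latinArray A z) j.succ ∈
      G.colourClass c EdgeColour.blue := fun j => by
    rw [verticalEdge_latinArray_succ]
    -- Column `j` meets part `l` in its copy `l - j`; the value of the choice function at 0 plays no
    -- role.
    exact hblue (Fin.cons j (Fin.cons j fun l => l - j))
  refine ⟨⟨latinArray_injective A z hA hz, fun i => ?_, fun j => ?_⟩, ?_, ?_⟩
  · refine Fin.cases ?_ (fun i => mem_edges_of_mem_colourClass (hh i)) i
    rwa [horizontalEdge_latinArray_zero]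
  · refine Fin.cases ?_ (fun j => mem_edges_of_mem_colourClass (hv j)) j
    rwa [verticalEdge_latinArray_zero]
  · refine (Finset.card_le_card (t := {0}) fun i hi => ?_).trans_eq (Finset.card_singleton _)
    refine Fin.cases (by simp) (fun i hi => ?_) i hi
    exact absurd (hh i) (Finset.mem_filter.mp hi).2
  · refine (Finset.card_le_card (t := {0}) fun j hj => ?_).trans_eq (Finset.card_singleton _)
    refine Fin.cases (by simp) (fun j hj => ?_) j hj
    exact absurd (hv j) (Finset.mem_filter.mp hj).2

end Grid

end KGraph

/-! ### Random families of parts -/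

section Parts

variable {V : Type*} [Fintype V]

theorem density_mixed_eq_density_fin {d : ℕ} (p q : (Fin d → V) → V → Prop) :
    density (fun x : ((Fin d → V) × V) × V => p x.1.1 x.1.2 ∧ q x.1.1 x.2) =
      density fun t : Fin (d + 2) → V =>
        p (fun l => t l.succ.succ) (t 0) ∧ q (fun l => t l.succ.succ) (t 1) := by
  let e : (Fin (d + 2) → V) ≃ ((Fin d → V) × V) × V :=
    { toFun := fun t => ((fun l => t l.succ.succ, t 0), t 1)
      invFun := fun x => Fin.cons x.1.2 (Fin.cons x.2 x.1.1)
      left_inv := fun t => by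
        funext l
        refine Fin.cases rfl (fun l => ?_) l
        exact Fin.cases rfl (fun l => rfl) l
      right_inv := fun x => rfl }
  exact (density_equiv e fun x => p x.1.1 x.1.2 ∧ q x.1.1 x.2).symm

theorem density_not_injective_parts_le [Nonempty V] (D m : ℕ) :
    density (fun A : Fin D → Fin m → V =>
        ¬ Function.Injective fun p : Fin D × Fin m => A p.1 p.2) ≤
      ((D * m : ℕ) : ℝ) ^ 2 / Fintype.card V := by
  refine (density_equiv (Equiv.curry (Fin D) (Fin m) V).symm
    fun a => ¬ Function.Injective a).trans_le (density_not_injective_le.trans_eq ?_)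
  simp

end Parts

/-! ### The dichotomy with explicit constants -/

namespace KGraph

theorem exists_isNearAlternatingGrid_or_colourClass_le {V : Type*} [Fintype V] [DecidableEq V]
    [Nonempty V] {d : ℕ} (G : KGraph V (d + 1)) (c : G.Colouring) (τ ζ : ℝ)
    (hτ0 : 0 < τ) (hτ1 : τ ≤ 1)
    (hmost : (d : ℝ) ^ 2 / Fintype.card V + d ^ d * ζ ≤ τ ^ 2 / (128 * (d + 1)))
    (hpos : (((d + 2) * d : ℕ) : ℝ) ^ 2 / Fintype.card V +
      2 * ((d : ℝ) ^ 2 / Fintype.card V + d ^ d * ζ) <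
        (τ ^ 4 / (512 * (d + 1))) ^ d ^ (d + 2))
    (hlarge : (((d + 2) * d : ℕ) : ℝ) / Fintype.card V < 2 * τ)
    (hG : (((Finset.univ.powersetCard d).filter
        (fun S : Finset V => (G.degree S : ℝ) < (1 / 2 + τ) * (Fintype.card V : ℝ))).card : ℝ)
      ≤ ζ * (Fintype.card V : ℝ) ^ d) :
    (∃ x, G.IsNearAlternatingGrid c x) ∨
      ∃ a, ((G.colourClass c a).card : ℝ) ≤ τ * (Fintype.card V : ℝ) ^ (d + 1) := by
  rw [or_iff_not_imp_right]
  intro hcol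
  push Not at hcol
  let few : (Fin d → V) → Prop := fun S => density (fun z => G.Extends c EdgeColour.red S z ∨
    G.Extends c EdgeColour.blue S z) < 1 / 2 + τ
  have hfew : density few ≤ (d : ℝ) ^ 2 / Fintype.card V + d ^ d * ζ :=
    density_few_extensions_le G c τ ζ hG
  have hmixed := density_mixed_ge (G.Extends c EdgeColour.red) (G.Extends c EdgeColour.blue)
    (extends_update G c _) (extends_update G c _) τ hτ0 hτ1 (hfew.trans hmost)
    (le_density_extends G c _ τ (hcol _).le) (le_density_extends G c _ τ (hcol _).le)
  rw [density_mixed_eq_density_fin] at hmixed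
  have hblow := (pow_le_pow_left₀ (by positivity) hmixed (d ^ (d + 2))).trans
    (pow_density_le_density_blowUp d (d + 2) _)
  have hbad : density (fun A : Fin (d + 2) → Fin d → V =>
      (¬ Function.Injective fun p : Fin (d + 2) × Fin d => A p.1 p.2) ∨ few (A 0) ∨ few (A 1)) ≤
      (((d + 2) * d : ℕ) : ℝ) ^ 2 / Fintype.card V +
        2 * ((d : ℝ) ^ 2 / Fintype.card V + d ^ d * ζ) := by
    refine (density_or_le _ _).trans (add_le_add (density_not_injective_parts_le _ _) ?_)
    refine (density_or_le _ _).trans ?_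
    -- Each part has exactly `d` elements, so `A 0` and `A 1` are themselves uniform `d`-tuples.
    rw [density_eval 0 few, density_eval 1 few]
    linarith
  obtain ⟨A, hA, hA'⟩ := exists_of_density_lt (hbad.trans_lt (hpos.trans_le hblow))
  simp only [not_or, not_not, few, not_lt, Extends, mem_colourClass_red_or_blue] at hA'
  obtain ⟨hinj, h0, h1⟩ := hA'
  -- The common extensions have density at least `2 * τ`, more than the vertices already used, which
  -- leaves a new one for the corner.
  have hboth := (sub_le_sub_right (add_le_add h0 h1) 1).trans (density_add_le_and _ _)
  have hused : density (fun z => ∃ p : Fin (d + 2) × Fin d, A p.1 p.2 = z) ≤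
      (((d + 2) * d : ℕ) : ℝ) / Fintype.card V := by
    rw [density_eq_card_div]
    gcongr
    rw [Finset.univ_filter_exists]
    exact Finset.card_image_le.trans_eq (by simp)
  obtain ⟨z, ⟨hz0, hz1⟩, hz⟩ := exists_of_density_lt
    (hused.trans_lt (hlarge.trans_le (le_trans (by linarith) hboth)))
  push Not at hz
  exact ⟨_, isNearAlternatingGrid_latinArray A z G c hinj (fun l i => hz (l, i)) hz0 hz1
    (fun φ => (hA φ).1) fun φ => (hA φ).2⟩

/-- For fixed `k` and `τ`, the dichotomy holds once `1 / n` and `ζ` are below a positive threshold. -/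
theorem exists_threshold (k : ℕ) (hk : 1 ≤ k) (τ : ℝ) (hτ0 : 0 < τ) (hτ1 : τ ≤ 1) :
    ∃ η ∈ Set.Ioc (0 : ℝ) 1, ∀ (n : ℕ) (ε ρ ζ : ℝ), 1 ≤ n → τ ≤ ε → τ ≤ ρ →
      1 / (n : ℝ) ≤ η → ζ ≤ η →
      ∀ (V : Type*) [Fintype V] [DecidableEq V], Fintype.card V = n →
        ∀ (G : KGraph V k) (c : G.Colouring),
          (((Finset.univ.powersetCard (k - 1)).filter
              (fun S : Finset V => (G.degree S : ℝ) < (1 / 2 + ε) * (n : ℝ))).card : ℝ)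
            ≤ ζ * (n : ℝ) ^ (k - 1) →
          (∃ x : Fin k → Fin k → V, G.IsNearAlternatingGrid c x) ∨
            ∃ a : EdgeColour, ((G.colourClass c a).card : ℝ) ≤ ρ * (n : ℝ) ^ k := by
  obtain ⟨d, rfl⟩ : ∃ d, k = d + 1 := ⟨k - 1, by omega⟩
  set a : ℝ := τ ^ 2 / (128 * (d + 1))
  set b : ℝ := (τ ^ 4 / (512 * (d + 1))) ^ d ^ (d + 2)
  set m : ℝ := (((d + 2) * d : ℕ) : ℝ)
  -- Adds up the coefficients of `1 / n` and `ζ` in all the error terms, so each of these is at most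
  -- `μ` when `1 / n` and `ζ` are at most `μ / K`. The final 1 ensures `K ≥ 1`.
  set K : ℝ := m ^ 2 + m + 2 * ((d : ℝ) ^ 2 + d ^ d) + 1
  have ha : 0 < a := by positivity
  have hb : 0 < b := by positivity
  have hm : 0 ≤ m := by positivity
  have hK : 1 ≤ K := by
    have : 0 ≤ m ^ 2 + m + 2 * ((d : ℝ) ^ 2 + d ^ d) := by positivity
    linarith
  set μ := min (min a (b / 2)) τ
  have hμ : 0 < μ := by positivity
  refine ⟨μ / K, ⟨by positivity, ?_⟩, ?_⟩
  · rw [div_le_one (by linarith)]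
    exact ((min_le_right _ _).trans hτ1).trans hK
  intro n ε ρ ζ hn hε hρ hnη hζη V _ _ hV G c hG
  subst hV
  have : Nonempty V := Fintype.card_pos_iff.mp hn
  have hn' : (0 : ℝ) < Fintype.card V := by exact_mod_cast hn
  have hη : 0 < μ / K := by positivity
  have hKη : K * (μ / K) = μ := by field_simp
  have hdiv : ∀ x : ℝ, 0 ≤ x → x / Fintype.card V ≤ x * (μ / K) := fun x hx => by
    rw [← mul_one_div]
    gcongr
  have h1 := hdiv (d ^ 2) (by positivity)
  have h2 := hdiv (m ^ 2) (by positivity)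
  have h3 := hdiv m (by positivity)
  have h4 : (d : ℝ) ^ d * ζ ≤ d ^ d * (μ / K) := by gcongr
  have hsq : 0 ≤ m ^ 2 * (μ / K) := by positivity
  have hm' : 0 ≤ m * (μ / K) := by positivity
  have hd2 : 0 ≤ (d : ℝ) ^ 2 * (μ / K) := by positivity
  have hdd : 0 ≤ (d : ℝ) ^ d * (μ / K) := by positivity
  have hexp : m ^ 2 * (μ / K) + m * (μ / K) +
      2 * ((d : ℝ) ^ 2 * (μ / K) + d ^ d * (μ / K)) + μ / K = μ := by
    refine Eq.trans ?_ hKη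
    generalize μ / K = y
    simp only [K]
    ring
  have hμa : μ ≤ a := (min_le_left _ _).trans (min_le_left _ _)
  have hμb : μ ≤ b / 2 := (min_le_left _ _).trans (min_le_right _ _)
  have hμτ : μ ≤ τ := min_le_right _ _
  simp only [Nat.add_sub_cancel] at hG
  refine (exists_isNearAlternatingGrid_or_colourClass_le G c τ ζ hτ0 hτ1 (by linarith)
    (by linarith) (by linarith) (le_trans ?_ hG)).imp_right ?_
  · norm_cast
    -- Lowering `ε` to `τ` only shrinks the set of exceptional sets.
    refine Finset.card_le_card (Finset.monotone_filter_right _ fun S _ hS => hS.trans_le ?_)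
    gcongr
  · rintro ⟨a, h⟩
    exact ⟨a, h.trans (by gcongr)⟩

end KGraph

/-! ### Packaging the thresholds into increasing functions -/

/-- Positive thresholds `η k m` that suffice for `1 / m ≤ ε, ρ` are bounded below by a single
strictly increasing function of `ε`, `ρ` and `1 / k`. -/
theorem exists_isHierarchyFunction_le (η : ℕ → ℕ → ℝ) (hη : ∀ k m, η k m ∈ Set.Ioc (0 : ℝ) 1) :
    ∃ g : ℝ → ℝ, IsHierarchyFunction g ∧ ∀ (k : ℕ) (ε ρ ζ : ℝ), 1 ≤ k →
      ε ∈ Set.Ioc (0 : ℝ) 1 → ρ ∈ Set.Ioc (0 : ℝ) 1 →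
      ζ ≤ g ε → ζ ≤ g ρ → ζ ≤ g (1 / (k : ℝ)) →
        ∃ m : ℕ, 1 ≤ m ∧ 1 / (m : ℝ) ≤ ε ∧ 1 / (m : ℝ) ≤ ρ ∧ ζ ≤ η k m := by
  -- All factors lie in `(0, 1]`, so the product is below each of them and decreases with `M`.
  let H : ℕ → ℝ := fun M =>
    ∏ p ∈ Finset.range (M + 1) ×ˢ Finset.range (M + 1), η p.1 p.2
  have hHpos : ∀ M, 0 < H M := fun M => Finset.prod_pos fun p _ => (hη _ _).1
  have hHanti : Antitone H := fun M N h =>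
    Finset.prod_le_prod_of_subset_of_le_one
      (Finset.product_subset_product (Finset.range_mono (by omega)) (Finset.range_mono (by omega)))
      (fun p _ => (hη _ _).1.le) fun p _ _ => (hη _ _).2
  have hHle : ∀ M k m, k ≤ M → m ≤ M → H M ≤ η k m := by
    intro M k m hk hm
    have h : {(k, m)} ⊆ Finset.range (M + 1) ×ˢ Finset.range (M + 1) := by
      simp only [Finset.singleton_subset_iff, Finset.mem_product, Finset.mem_range]
      omega
    exact (Finset.prod_le_prod_of_subset_of_le_one h (fun p _ => (hη _ _).1.le)
      fun p _ _ => (hη _ _).2).trans_eq (Finset.prod_singleton _ _)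
  have hH1 : ∀ M, H M ≤ 1 := fun M => (hHle M 0 0 (Nat.zero_le _) (Nat.zero_le _)).trans (hη _ _).2
  -- The step function `H ⌈1 / t⌉₊` is only weakly increasing; the factor `t` makes it strict.
  refine ⟨fun t => t * H ⌈1 / t⌉₊, ⟨fun t ht => ⟨mul_pos ht.1 (hHpos _), ?_⟩, ?_⟩, ?_⟩
  · exact mul_le_one₀ ht.2 (hHpos _).le (hH1 _)
  · intro s hs t ht hst
    have h : H ⌈1 / s⌉₊ ≤ H ⌈1 / t⌉₊ :=
      hHanti (Nat.ceil_mono (one_div_le_one_div_of_le hs.1 hst.le))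
    exact (mul_lt_mul_of_pos_right hst (hHpos _)).trans_le (mul_le_mul_of_nonneg_left h ht.1.le)
  · intro k ε ρ ζ hk hε hρ h1 h2 h3
    have hk' : (1 : ℝ) ≤ k := by exact_mod_cast hk
    have hdrop : ∀ t ∈ Set.Ioc (0 : ℝ) 1, ζ ≤ t * H ⌈1 / t⌉₊ → ζ ≤ H ⌈1 / t⌉₊ := fun t ht h =>
      h.trans (mul_le_of_le_one_left (hHpos _).le ht.2)
    have h1 := hdrop _ hε h1
    have h2 := hdrop _ hρ h2
    have h3 := hdrop _ ⟨by positivity, by rw [div_le_one (by linarith)]; exact hk'⟩ h3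
    rw [one_div_one_div, Nat.ceil_natCast] at h3
    have hmax : ∀ M N, ζ ≤ H M → ζ ≤ H N → ζ ≤ H (max M N) := fun M N hM hN => by
      rcases max_choice M N with h | h <;> rwa [h]
    have hinv : ∀ t ∈ Set.Ioc (0 : ℝ) 1, ∀ M : ℕ, ⌈1 / t⌉₊ ≤ M → 1 / (M : ℝ) ≤ t :=
      fun t ht M hM => by
        have h := (Nat.le_ceil (1 / t)).trans (Nat.cast_le.mpr hM)
        exact (one_div_le ht.1 (lt_of_lt_of_le (by have := ht.1; positivity) h)).mp h
    -- `H` at this maximum is one of the three values already known to be at least `ζ`.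
    refine ⟨max k (max ⌈1 / ε⌉₊ ⌈1 / ρ⌉₊), hk.trans (le_max_left _ _),
      hinv ε hε _ ((le_max_left _ _).trans (le_max_right _ _)),
      hinv ρ hρ _ ((le_max_right _ _).trans (le_max_right _ _)),
      (hmax _ _ h3 (hmax _ _ h1 h2)).trans (hHle _ _ _ (le_max_left _ _) le_rfl)⟩

theorem lemma4p1 :
    ∃ f g : ℝ → ℝ, IsHierarchyFunction f ∧ IsHierarchyFunction g ∧
      ∀ (k n : ℕ) (ε ρ ζ : ℝ), 3 ≤ k → 1 ≤ n →
        ε ∈ Set.Ioc (0 : ℝ) 1 → ρ ∈ Set.Ioc (0 : ℝ) 1 → ζ ∈ Set.Ioc (0 : ℝ) 1 →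
        1 / (n : ℝ) ≤ f ζ →
        ζ ≤ g ε → ζ ≤ g ρ → ζ ≤ g (1 / (k : ℝ)) →
        ∀ (V : Type*) [Fintype V] [DecidableEq V], Fintype.card V = n →
          ∀ (G : KGraph V k) (c : G.Colouring),
            (((Finset.univ.powersetCard (k - 1)).filter
                (fun S : Finset V => (G.degree S : ℝ) < (1 / 2 + ε) * (n : ℝ))).card : ℝ)
              ≤ ζ * (n : ℝ) ^ (k - 1) →
            (∃ x : Fin k → Fin k → V, G.IsNearAlternatingGrid c x) ∨
              ∃ a : EdgeColour, ((G.colourClass c a).card : ℝ) ≤ ρ * (n : ℝ) ^ k := by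
  have hτ : ∀ m : ℕ, 0 < 1 / ((m + 1 : ℕ) : ℝ) ∧ 1 / ((m + 1 : ℕ) : ℝ) ≤ 1 := fun m =>
    ⟨by positivity, by rw [div_le_one (by positivity)]; exact_mod_cast Nat.le_add_left 1 m⟩
  choose η hη H using fun k m : ℕ =>
    KGraph.exists_threshold (k + 1) (Nat.le_add_left 1 k) _ (hτ m).1 (hτ m).2
  obtain ⟨g, hg, hgη⟩ := exists_isHierarchyFunction_le (fun k m => η (k - 1) (m - 1))
    fun k m => hη _ _
  -- The identity suffices for `f`: `1 / n ≤ ζ` places `1 / n` below the same threshold as `ζ`.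
  refine ⟨id, g, ⟨fun t ht => ht, fun s _ t _ hst => hst⟩, hg, ?_⟩
  intro k n ε ρ ζ hk hn hε hρ _ hnζ h1 h2 h3
  obtain ⟨m, hm, hmε, hmρ, hζ⟩ := hgη k ε ρ ζ (by omega) hε hρ h1 h2 h3
  obtain ⟨k, rfl⟩ : ∃ j, k = j + 1 := ⟨k - 1, by omega⟩
  obtain ⟨m, rfl⟩ : ∃ j, m = j + 1 := ⟨m - 1, by omega⟩
  exact H k m n ε ρ ζ hn hmε hmρ (hnζ.trans hζ) hζ
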